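/- Let $k$ be a field, let $G$ be a finite abelian group that splits over $k$ (that is, the group algebra $kG$ is isomorphic as a $k$-algebra to a finite product of copies of $k$), and let $\mathcal{C}$ be a skeletally small $k$-linear additive category that is idempotent complete. Let a $k$-linear $G$-action on $\mathcal{C}$ be given, that is, $k$-linear autoequivalences $F_g\colon\mathcal{C}\to\mathcal{C}$ $(g\in G)$ and natural isomorphisms $\varepsilon_{g,h}\colon F_gF_h\to F_{gh}$ with $\varepsilon_{gh,l}\circ\varepsilon_{g,h}F_l=\varepsilon_{g,hl}\circ F_g\varepsilon_{h,l}$ for all $g,h,l\in G$. Let $\mathcal{C}^G$ be the category of $G$-equivariant objects: pairs $(X,\alpha)$ of an object $X$ of $\mathcal{C}$ and isomorphisms $\alpha_g\colon X\to F_g(X)$ $(g\in G)$ with $\alpha_{gh}=(\varepsilon_{g,h})_X\circ F_g(\alpha_h)\circ\alpha_g$; a morphism $(X,\alpha)\to(Y,\beta)$ is a morphism $f\colon X\to Y$ with $\beta_g\circ f=F_g(f)\circ\alpha_g$ for all $g$. The character group $\widehat{G}=\mathrm{Hom}(G,k^*)$ acts strictly and $k$-linearly on $\mathcal{C}^G$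 by $F_\chi(X,\alpha)=(X,(\chi(g^{-1})\alpha_g)_{g\in G})$, $F_\chi(f)=f$ (the dual action). For a $k$-linear category $\mathcal{D}$ with a $k$-linear action $\{F_h,\varepsilon_{h,h'}\}$ of a group $H$, let $\mathrm{Aut}(\mathcal{D};H)$ be the group of isomorphism classes $[F,\delta]$ of $k$-linear $H$-equivariant autoequivalences: $F\colon\mathcal{D}\to\mathcal{D}$ is a $k$-linear autoequivalence and $\delta_h\colon FF_h\to F_hF$ are natural isomorphisms with $\delta_{hh'}\circ F\varepsilon_{h,h'}=\varepsilon_{h,h'}F\circ F_h\delta_{h'}\circ\delta_hF_{h'}$. An isomorphism $(F,\delta)\to(F',\delta')$ is a natural isomorphism $\phi\colon F\to F'$ with $F_h\phi\circ\delta_h=\delta'_h\circ\phi F_h$ for all $h$, and the product is $[F,\delta][F',\delta']=[FF',(\delta_hF'\circ F\delta'_h)_h]$. Let $\mathrm{Act}(\mathcal{D};H)\subseteq\mathrm{Aut}(\mathcal{D};H)$ be the subgroup of those $[F,\delta]$ such that $F$ is isomorphic, as a functor, to $F_a$ for some $a\in H$. The equivariantization homomorphism $(-)^G\colon\mathrm{Aut}(\mathcal{C};G)\to\mathrm{Aut}(\mathcal{C}^G;\widehat{G})$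 sends $[F,\delta]$ to the class of the functor $(X,\alpha)\mapsto(F(X),((\delta_g)_X\circ F(\alpha_g))_{g\in G})$, $f\mapsto F(f)$, which commutes strictly with every $F_\chi$ and is given the identities as its $\widehat{G}$-equivariant structure. For a $k$-linear category $\mathcal{D}$ let $Z(\mathcal{D})$ be the $k$-algebra of natural endomorphisms of $\mathrm{Id}_{\mathcal{D}}$; write $Z(\mathcal{D})=k$ if the structure map $k\to Z(\mathcal{D})$ is bijective. Assume that $Z(\mathcal{C})=k=Z(\mathcal{C}^G)$. Then $(-)^G$ restricts to an isomorphism of groups $$(-)^G\colon\mathrm{Act}(\mathcal{C};G)\longrightarrow\mathrm{Act}(\mathcal{C}^G;\widehat{G}).$$ -/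

import Mathlib

open CategoryTheory CategoryTheory.Limits

namespace Equivariantization

universe w x v u

lemma id_comm {C : Type u} [Category.{v} C] {F : C ⥤ C} {X : C} {a b : X ⟶ F.obj X}
    (h : a = b) : 𝟙 X ≫ a = b ≫ F.map (𝟙 X) := by
  simp [h]

/-- A `k`-linear action of a group `G` on a `k`-linear category `C`: `k`-linear autoequivalences
`F g` and natural isomorphisms `ε g h : F_g F_h ≅ F_{gh}` satisfying the 2-cocycle condition
`ε_{gh,l} ∘ ε_{g,h} F_l = ε_{g,hl} ∘ F_g ε_{h,l}`.  In Lean `F h ⋙ F g` is the composite `F_g F_h`;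
the `eqToHom` only identifies `F_{(gh)l}` with `F_{g(hl)}`. -/
structure LinearAction (k : Type w) [Field k] (G : Type x) [Group G]
    (C : Type u) [Category.{v} C] [Preadditive C] [Linear k C] where
  F : G → C ⥤ C
  isEquivalence : ∀ g, (F g).IsEquivalence
  additive : ∀ g, (F g).Additive
  linear : ∀ g, (F g).Linear k
  ε : ∀ g h : G, F h ⋙ F g ≅ F (g * h)
  cocycle : ∀ (g h l : G) (X : C),
    (ε g h).hom.app ((F l).obj X) ≫ (ε (g * h) l).hom.app X ≫
        eqToHom (congrArg (fun a => (F a).obj X) (mul_assoc g h l)) =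
      (F g).map ((ε h l).hom.app X) ≫ (ε g (h * l)).hom.app X

section

variable {k : Type w} [Field k] {G : Type x} [Group G]
  {C : Type u} [Category.{v} C] [Preadditive C] [Linear k C]

attribute [instance] LinearAction.isEquivalence LinearAction.additive LinearAction.linear

/-! ### The category of equivariant objects -/

/-- A `G`-equivariant object `(X, α)`: isomorphisms `α_g : X ≅ F_g X` with
`α_{gh} = (ε_{g,h})_X ∘ F_g(α_h) ∘ α_g`. -/
structure EquivariantObject (A : LinearAction k G C) where
  X : C
  α : ∀ g : G, X ≅ (A.F g).obj X
  rel : ∀ g h : G,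
    (α (g * h)).hom = (α g).hom ≫ (A.F g).map (α h).hom ≫ (A.ε g h).hom.app X

namespace EquivariantObject

variable {A : LinearAction k G C}

/-- A morphism `(X, α) ⟶ (Y, β)` is an `f : X ⟶ Y` with `β_g ∘ f = F_g(f) ∘ α_g`. -/
@[ext]
structure Hom (P Q : EquivariantObject A) where
  f : P.X ⟶ Q.X
  comm : ∀ g : G, f ≫ (Q.α g).hom = (P.α g).hom ≫ (A.F g).map f

lemma Hom.comm_assoc {P Q : EquivariantObject A} (a : Hom P Q) (g : G) {Z : C}
    (h : (A.F g).obj Q.X ⟶ Z) :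
    a.f ≫ (Q.α g).hom ≫ h = (P.α g).hom ≫ (A.F g).map a.f ≫ h := by
  rw [← Category.assoc, a.comm, Category.assoc]

instance : Category (EquivariantObject A) where
  Hom P Q := Hom P Q
  id P := { f := 𝟙 P.X, comm := fun g => by simp }
  comp a b := { f := a.f ≫ b.f, comm := fun g => by simp [Hom.comm, Hom.comm_assoc] }

@[simp] lemma id_f (P : EquivariantObject A) : Hom.f (𝟙 P) = 𝟙 P.X := rfl

@[simp] lemma comp_f {P Q R : EquivariantObject A} (a : P ⟶ Q) (b : Q ⟶ R) :
    (a ≫ b).f = a.f ≫ b.f := rfl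

@[ext]
lemma hom_ext {P Q : EquivariantObject A} {a b : P ⟶ Q} (h : a.f = b.f) : a = b :=
  Hom.ext h

lemma eqToHom_f {P Q : EquivariantObject A} (h : P = Q) :
    (eqToHom h).f = eqToHom (congrArg EquivariantObject.X h) := by
  subst h
  rfl

/-- An isomorphism of equivariant objects from an isomorphism of the underlying objects. -/
@[simps]
def isoMk {P Q : EquivariantObject A} (e : P.X ≅ Q.X)
    (comm : ∀ g : G, e.hom ≫ (Q.α g).hom = (P.α g).hom ≫ (A.F g).map e.hom) : P ≅ Q where
  hom := { f := e.hom, comm := comm }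
  inv :=
    { f := e.inv
      comm := fun g => by
        rw [Iso.inv_comp_eq, ← Category.assoc, comm g, Category.assoc, ← Functor.map_comp]
        simp }
  hom_inv_id := by ext; simp
  inv_hom_id := by ext; simp

variable (P Q : EquivariantObject A)

instance : Add (P ⟶ Q) where
  add a b := { f := a.f + b.f, comm := fun g => by simp [Hom.comm, Functor.map_add] }

instance : Zero (P ⟶ Q) where
  zero := { f := 0, comm := fun g => by simp }

instance : Neg (P ⟶ Q) where
  neg a := { f := -a.f, comm := fun g => by simp [Hom.comm, Functor.map_neg] }

instance : Sub (P ⟶ Q) where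
  sub a b := { f := a.f - b.f, comm := fun g => by simp [Hom.comm, Functor.map_sub] }

instance : SMul k (P ⟶ Q) where
  smul c a := { f := c • a.f, comm := fun g => by simp [Hom.comm, Functor.map_smul] }

instance : SMul ℕ (P ⟶ Q) where
  smul n a := { f := n • a.f, comm := fun g => by simp [Hom.comm] }

instance : SMul ℤ (P ⟶ Q) where
  smul n a := { f := n • a.f, comm := fun g => by simp [Hom.comm] }

variable {P Q}

@[simp] lemma add_f (a b : P ⟶ Q) : (a + b).f = a.f + b.f := rfl
@[simp] lemma zero_f : (0 : P ⟶ Q).f = 0 := rfl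
@[simp] lemma neg_f (a : P ⟶ Q) : (-a).f = -a.f := rfl
@[simp] lemma sub_f (a b : P ⟶ Q) : (a - b).f = a.f - b.f := rfl
@[simp] lemma smul_f (c : k) (a : P ⟶ Q) : (c • a).f = c • a.f := rfl

lemma f_injective : Function.Injective (fun a : P ⟶ Q => a.f) := fun _ _ h => hom_ext h

instance : AddCommGroup (P ⟶ Q) :=
  f_injective.addCommGroup _ rfl (fun _ _ => rfl) (fun _ => rfl) (fun _ _ => rfl)
    (fun _ _ => rfl) (fun _ _ => rfl)

instance : Preadditive (EquivariantObject A) where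
  add_comp _ _ _ a b c := by ext; simp
  comp_add _ _ _ a b c := by ext; simp

/-- The underlying morphism, as an additive map. -/
def fAddHom : (P ⟶ Q) →+ (P.X ⟶ Q.X) where
  toFun a := a.f
  map_zero' := rfl
  map_add' _ _ := rfl

instance : Module k (P ⟶ Q) :=
  Function.Injective.module k fAddHom f_injective (fun _ _ => rfl)

instance : Linear k (EquivariantObject A) where
  smul_comp _ _ _ c a b := by ext; simp
  comp_smul _ _ _ a c b := by ext; simp

end EquivariantObject

/-! ### The group of equivariant autoequivalences -/

/-- A `k`-linear `G`-equivariant autoequivalence `(F, δ)`, with `δ_g : F F_g ≅ F_g F` satisfying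
`δ_{gh} ∘ F ε_{g,h} = ε_{g,h} F ∘ (F_g δ_h ∘ δ_g F_h)`. -/
structure EquivariantAutoequivalence (A : LinearAction k G C) where
  F : C ⥤ C
  isEquivalence : F.IsEquivalence
  additive : F.Additive
  linear : F.Linear k
  δ : ∀ g : G, A.F g ⋙ F ≅ F ⋙ A.F g
  compat : ∀ (g h : G) (X : C),
    F.map ((A.ε g h).hom.app X) ≫ (δ (g * h)).hom.app X =
      (δ g).hom.app ((A.F h).obj X) ≫ (A.F g).map ((δ h).hom.app X) ≫
        (A.ε g h).hom.app (F.obj X)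

attribute [instance] EquivariantAutoequivalence.isEquivalence
  EquivariantAutoequivalence.additive EquivariantAutoequivalence.linear

namespace EquivariantAutoequivalence

variable {A : LinearAction k G C}

/-- Isomorphism of equivariant autoequivalences: a natural isomorphism `φ : F ≅ F'` with
`F_g φ ∘ δ_g = δ'_g ∘ φ F_g`. -/
def Isomorphic (E E' : EquivariantAutoequivalence A) : Prop :=
  ∃ φ : E.F ≅ E'.F, ∀ (g : G) (X : C),
    (E.δ g).hom.app X ≫ (A.F g).map (φ.hom.app X) =
      φ.hom.app ((A.F g).obj X) ≫ (E'.δ g).hom.app X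

lemma isomorphic_refl (E : EquivariantAutoequivalence A) : E.Isomorphic E :=
  ⟨Iso.refl _, fun g X => by simp⟩

lemma Isomorphic.symm {E E' : EquivariantAutoequivalence A} (h : E.Isomorphic E') :
    E'.Isomorphic E := by
  obtain ⟨φ, hφ⟩ := h
  refine ⟨φ.symm, fun g X => ?_⟩
  rw [← cancel_epi (φ.hom.app ((A.F g).obj X)), ← Category.assoc, ← hφ, Category.assoc,
    ← Functor.map_comp]
  simp

lemma Isomorphic.trans {E E' E'' : EquivariantAutoequivalence A} (h : E.Isomorphic E')
    (h' : E'.Isomorphic E'') : E.Isomorphic E'' := by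
  obtain ⟨φ, hφ⟩ := h
  obtain ⟨ψ, hψ⟩ := h'
  refine ⟨φ ≪≫ ψ, fun g X => ?_⟩
  simp only [Iso.trans_hom, NatTrans.comp_app, Functor.map_comp, Category.assoc]
  rw [← Category.assoc, hφ, Category.assoc, hψ]

instance setoid (A : LinearAction k G C) : Setoid (EquivariantAutoequivalence A) where
  r := Isomorphic
  iseqv := ⟨isomorphic_refl, Isomorphic.symm, Isomorphic.trans⟩

/-- The identity equivariant functor. -/
def one (A : LinearAction k G C) : EquivariantAutoequivalence A where
  F := 𝟭 C
  isEquivalence := inferInstance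
  additive := inferInstance
  linear := inferInstance
  δ g := NatIso.ofComponents (fun X => Iso.refl _) (by intros; simp)
  compat g h X := by simp

/-- The composite `(F, δ)(F', δ') = (F F', (δ_g F' ∘ F δ'_g)_g)`. -/
def comp (E E' : EquivariantAutoequivalence A) : EquivariantAutoequivalence A where
  F := E'.F ⋙ E.F
  isEquivalence := inferInstance
  additive := inferInstance
  linear := inferInstance
  δ g := NatIso.ofComponents
    (fun X => E.F.mapIso ((E'.δ g).app X) ≪≫ (E.δ g).app (E'.F.obj X))
    (by
      intro X Y f
      have h1 := (E'.δ g).hom.naturality f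
      have h2 := (E.δ g).hom.naturality (E'.F.map f)
      simp only [Functor.comp_map] at h1 h2
      simp only [Functor.comp_map, Iso.trans_hom, Functor.mapIso_hom, Iso.app_hom,
        Category.assoc]
      rw [← h2, ← Functor.map_comp_assoc, h1, Functor.map_comp_assoc])
  compat g h X := by
    have h1 := E'.compat g h X
    have h2 := E.compat g h (E'.F.obj X)
    have h3 := (E.δ g).hom.naturality ((E'.δ h).hom.app X)
    simp only [Functor.comp_map] at h3
    simp only [NatIso.ofComponents_hom_app, Iso.trans_hom, Functor.mapIso_hom, Iso.app_hom,
      Functor.comp_map, Functor.map_comp, Category.assoc, Functor.comp_obj] at *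
    rw [← Functor.map_comp_assoc, h1]
    simp only [Functor.map_comp, Category.assoc, h2]
    rw [reassoc_of% h3]

/-- The components `F F⁻¹ X ≅ X` of the counit of an equivariant autoequivalence. -/
noncomputable def cIso (E : EquivariantAutoequivalence A) (X : C) :
    E.F.obj (E.F.inv.obj X) ≅ X :=
  E.F.asEquivalence.counitIso.app X

lemma counit_naturality (E : EquivariantAutoequivalence A) {X Y : C} (f : X ⟶ Y) :
    E.F.map (E.F.inv.map f) ≫ (E.cIso Y).hom = (E.cIso X).hom ≫ f :=
  E.F.asEquivalence.counitIso.hom.naturality f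

lemma counit_inv_naturality (E : EquivariantAutoequivalence A) {X Y : C} (f : X ⟶ Y) :
    f ≫ (E.cIso Y).inv = (E.cIso X).inv ≫ E.F.map (E.F.inv.map f) :=
  E.F.asEquivalence.counitIso.inv.naturality f

/-- The components of the equivariant structure on a quasi-inverse. -/
noncomputable def inverseδApp (E : EquivariantAutoequivalence A) (g : G) (X : C) :
    E.F.inv.obj ((A.F g).obj X) ≅ (A.F g).obj (E.F.inv.obj X) :=
  E.F.preimageIso
    (E.cIso ((A.F g).obj X) ≪≫
      (A.F g).mapIso (E.cIso X).symm ≪≫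
      ((E.δ g).app (E.F.inv.obj X)).symm)

lemma map_inverseδApp (E : EquivariantAutoequivalence A) (g : G) (X : C) :
    E.F.map (E.inverseδApp g X).hom =
      (E.cIso ((A.F g).obj X)).hom ≫
        (A.F g).map (E.cIso X).inv ≫
          (E.δ g).inv.app (E.F.inv.obj X) := by
  simp [inverseδApp]

lemma δ_inv_naturality (E : EquivariantAutoequivalence A) (g : G) {X Y : C} (f : X ⟶ Y) :
    (A.F g).map (E.F.map f) ≫ (E.δ g).inv.app Y =
      (E.δ g).inv.app X ≫ E.F.map ((A.F g).map f) :=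
  (E.δ g).inv.naturality f

lemma ε_naturality (g h : G) {X Y : C} (f : X ⟶ Y) :
    (A.F g).map ((A.F h).map f) ≫ (A.ε g h).hom.app Y =
      (A.ε g h).hom.app X ≫ (A.F (g * h)).map f :=
  (A.ε g h).hom.naturality f

lemma compat_inv (E : EquivariantAutoequivalence A) (g h : G) (X : C) :
    (A.F g).map ((E.δ h).inv.app X) ≫ (E.δ g).inv.app ((A.F h).obj X) ≫
        E.F.map ((A.ε g h).hom.app X) =
      (A.ε g h).hom.app (E.F.obj X) ≫ (E.δ (g * h)).inv.app X := by
  rw [← cancel_mono ((E.δ (g * h)).hom.app X)]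
  simp only [Category.assoc, E.compat]
  simp [← Functor.map_comp_assoc]

/-- A quasi-inverse of an equivariant autoequivalence, with its induced equivariant structure. -/
noncomputable def inverse (E : EquivariantAutoequivalence A) : EquivariantAutoequivalence A where
  F := E.F.inv
  isEquivalence := inferInstance
  additive :=
    haveI : E.F.asEquivalence.functor.Additive := E.additive
    inferInstanceAs (E.F.asEquivalence.inverse.Additive)
  linear :=
    haveI : E.F.asEquivalence.functor.Additive := E.additive
    haveI : E.F.asEquivalence.functor.Linear k := E.linear
    inferInstanceAs (E.F.asEquivalence.inverse.Linear k)
  δ g := NatIso.ofComponents (fun X => E.inverseδApp g X) (by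
    intro X Y f
    apply E.F.map_injective
    simp only [Functor.comp_map, Functor.comp_obj, Functor.map_comp, map_inverseδApp,
      Category.assoc]
    rw [reassoc_of% (E.counit_naturality ((A.F g).map f)), ← E.δ_inv_naturality,
      ← Functor.map_comp_assoc, ← Functor.map_comp_assoc, E.counit_inv_naturality])
  compat g h X := by
    apply E.F.map_injective
    simp only [NatIso.ofComponents_hom_app, Functor.map_comp, map_inverseδApp, Category.assoc]
    rw [← reassoc_of% (E.δ_inv_naturality g (E.inverseδApp h X).hom), map_inverseδApp,
      reassoc_of% (E.counit_naturality ((A.ε g h).hom.app X))]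
    simp only [Functor.map_comp, Category.assoc, E.compat_inv]
    rw [← reassoc_of% (ε_naturality (A := A) g h), ← Functor.map_comp_assoc (A.F g)]
    simp

lemma inverse_comp (E : EquivariantAutoequivalence A) :
    (E.comp E.inverse).Isomorphic (one A) := by
  refine ⟨NatIso.ofComponents (fun X => E.cIso X) (fun f => E.counit_naturality f),
    fun g X => ?_⟩
  have := E.map_inverseδApp g X
  simp only [comp, inverse, one, NatIso.ofComponents_hom_app, Iso.trans_hom, Functor.mapIso_hom,
    Iso.app_hom, Category.assoc, this]
  simp [← Functor.map_comp]

lemma Isomorphic.comp {E E' D D' : EquivariantAutoequivalence A} (h : E.Isomorphic E')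
    (h' : D.Isomorphic D') : (E.comp D).Isomorphic (E'.comp D') := by
  obtain ⟨φ, hφ⟩ := h
  obtain ⟨ψ, hψ⟩ := h'
  refine ⟨NatIso.hcomp ψ φ, fun g X => ?_⟩
  have h1 : E.F.map ((A.F g).map (ψ.hom.app X)) ≫ (E.δ g).hom.app (D'.F.obj X) =
      (E.δ g).hom.app (D.F.obj X) ≫ (A.F g).map (E.F.map (ψ.hom.app X)) :=
    (E.δ g).hom.naturality (ψ.hom.app X)
  have h2 := φ.hom.naturality ((D'.δ g).hom.app X)
  have h3 := hφ g (D'.F.obj X)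
  have h4 := hψ g X
  simp only [EquivariantAutoequivalence.comp, NatIso.ofComponents_hom_app, Iso.trans_hom,
    Functor.mapIso_hom, Iso.app_hom, NatIso.hcomp, NatTrans.hcomp_app, Functor.comp_obj,
    Functor.map_comp, Category.assoc] at *
  have h5 := φ.hom.naturality (ψ.hom.app ((A.F g).obj X))
  have h6 := φ.hom.naturality (ψ.hom.app X)
  rw [← Functor.map_comp, ← h6, Functor.map_comp, ← reassoc_of% h1, h3,
    ← Functor.map_comp_assoc, h4, Functor.map_comp_assoc, reassoc_of% h2, reassoc_of% h5]

lemma comp_assoc (E E' E'' : EquivariantAutoequivalence A) :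
    ((E.comp E').comp E'').Isomorphic (E.comp (E'.comp E'')) :=
  ⟨NatIso.ofComponents (fun X => Iso.refl _) (by intros; simp [comp]),
    fun g X => by simp [comp]⟩

lemma comp_one (E : EquivariantAutoequivalence A) : (E.comp (one A)).Isomorphic E :=
  ⟨NatIso.ofComponents (fun X => Iso.refl _) (by intros; simp [comp, one]),
    fun g X => by simp [comp, one]⟩

end EquivariantAutoequivalence

namespace LinearAction

open EquivariantAutoequivalence

/-- The group `Aut(C; G)` of isomorphism classes of `k`-linear equivariant autoequivalences;
its multiplication is `[F, δ] [F', δ'] = [(F, δ)(F', δ')]`. -/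
def AutGroup (A : LinearAction k G C) := Quotient (setoid A)

/-- The class `[F, δ]` in `Aut(C; G)`. -/
def cls {A : LinearAction k G C} (E : EquivariantAutoequivalence A) : A.AutGroup :=
  Quotient.mk (setoid A) E

instance (A : LinearAction k G C) : Mul A.AutGroup where
  mul := Quotient.map₂ comp (fun _ _ h _ _ h' => Isomorphic.comp h h')

instance (A : LinearAction k G C) : One A.AutGroup where
  one := cls (one A)

noncomputable instance (A : LinearAction k G C) : Inv A.AutGroup where
  inv x := cls (inverse x.out)

lemma cls_mul_cls {A : LinearAction k G C} (E E' : EquivariantAutoequivalence A) :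
    cls E * cls E' = cls (E.comp E') := rfl

lemma cls_eq_cls {A : LinearAction k G C} {E E' : EquivariantAutoequivalence A} :
    cls E = cls E' ↔ E.Isomorphic E' := Quotient.eq (r := setoid A)

lemma cls_surjective {A : LinearAction k G C} (x : A.AutGroup) : ∃ E, cls E = x :=
  Quotient.exists_rep x

noncomputable instance (A : LinearAction k G C) : Group A.AutGroup :=
  Group.ofRightAxioms
    (fun x y z => by
      obtain ⟨E, rfl⟩ := cls_surjective x
      obtain ⟨E', rfl⟩ := cls_surjective y
      obtain ⟨E'', rfl⟩ := cls_surjective z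
      exact cls_eq_cls.2 (comp_assoc E E' E''))
    (fun x => by
      obtain ⟨E, rfl⟩ := cls_surjective x
      exact cls_eq_cls.2 (comp_one E))
    (fun x => by
      have h : cls x.out = x := Quotient.out_eq x
      have h' : cls x.out * x⁻¹ = 1 := cls_eq_cls.2 (inverse_comp x.out)
      rwa [h] at h')

lemma cls_inv {A : LinearAction k G C} (E : EquivariantAutoequivalence A) :
    (cls E)⁻¹ = cls E.inverse :=
  inv_eq_of_mul_eq_one_right (cls_eq_cls.2 (inverse_comp E))

/-- `F_e` is isomorphic to the identity functor. -/
lemma nonempty_unitIso (A : LinearAction k G C) : Nonempty (A.F 1 ≅ 𝟭 C) := by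
  have e : A.F 1 ⋙ A.F 1 ≅ A.F 1 := A.ε 1 1 ≪≫ eqToIso (by rw [mul_one])
  let a := (A.F 1).asEquivalence
  exact ⟨(Functor.rightUnitor _).symm ≪≫ Functor.isoWhiskerLeft (A.F 1) a.unitIso ≪≫
    (Functor.associator _ _ _).symm ≪≫ Functor.isoWhiskerRight e a.inverse ≪≫ a.unitIso.symm⟩

/-- The subgroup `Act(C; G)` of `Aut(C; G)`: the classes `[F, δ]` with `F` isomorphic to `F_a`
for some `a ∈ G`. -/
noncomputable def act (A : LinearAction k G C) : Subgroup A.AutGroup where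
  carrier := {x | ∃ E : EquivariantAutoequivalence A, cls E = x ∧ ∃ a : G, Nonempty (E.F ≅ A.F a)}
  one_mem' := by
    obtain ⟨u⟩ := A.nonempty_unitIso
    exact ⟨one A, rfl, 1, ⟨u.symm⟩⟩
  mul_mem' := by
    rintro _ _ ⟨E, rfl, a, ⟨φ⟩⟩ ⟨E', rfl, b, ⟨ψ⟩⟩
    exact ⟨E.comp E', rfl, a * b, ⟨NatIso.hcomp ψ φ ≪≫ A.ε a b⟩⟩
  inv_mem' := by
    rintro _ ⟨E, rfl, a, ⟨φ⟩⟩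
    obtain ⟨u⟩ := A.nonempty_unitIso
    have e : A.F a ⋙ A.F a⁻¹ ≅ 𝟭 C := A.ε a⁻¹ a ≪≫ eqToIso (by rw [inv_mul_cancel]) ≪≫ u
    refine ⟨E.inverse, (cls_inv E).symm, a⁻¹, ⟨?_⟩⟩
    exact (Functor.rightUnitor _).symm ≪≫
      Functor.isoWhiskerLeft E.F.inv (e.symm ≪≫ Functor.isoWhiskerRight φ.symm _) ≪≫
      (Functor.associator _ _ _).symm ≪≫
      Functor.isoWhiskerRight E.F.asEquivalence.counitIso _ ≪≫ Functor.leftUnitor _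

/-- Membership in `Act(C; G)` does not depend on the representative. -/
lemma cls_mem_act_iff {A : LinearAction k G C} (E : EquivariantAutoequivalence A) :
    cls E ∈ A.act ↔ ∃ a : G, Nonempty (E.F ≅ A.F a) := by
  constructor
  · rintro ⟨E', h, a, ⟨φ⟩⟩
    obtain ⟨ψ, -⟩ := cls_eq_cls.1 h
    exact ⟨a, ⟨ψ.symm ≪≫ φ⟩⟩
  · intro h
    exact ⟨E, rfl, h⟩

/-! ### The dual action -/

/-- The automorphism `F_χ (X, α) = (X, χ ⊗ α)` of the category of equivariant objects, where
`(χ ⊗ α)_g = χ(g⁻¹) α_g`; it is the identity on morphisms. -/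
@[simps]
def dualFunctor (A : LinearAction k G C) (χ : G →* kˣ) :
    EquivariantObject A ⥤ EquivariantObject A where
  obj P :=
    { X := P.X
      α := fun g =>
        { hom := (χ g⁻¹ : k) • (P.α g).hom
          inv := (χ g : k) • (P.α g).inv
          hom_inv_id := by simp [smul_smul]
          inv_hom_id := by simp [smul_smul] }
      rel := fun g h => by
        simp [P.rel, smul_smul, Functor.map_smul, mul_comm] }
  map a := { f := a.f, comm := fun g => by simp [a.comm] }

lemma smul_comm_iff {F : C ⥤ C} [F.Linear k] {X Y : C} (c : kˣ) {a : X ⟶ F.obj X}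
    {b : Y ⟶ F.obj Y} {f : X ⟶ Y} :
    f ≫ ((c : k) • b) = ((c : k) • a) ≫ F.map f ↔ f ≫ b = a ≫ F.map f := by
  rw [Linear.comp_smul, Linear.smul_comp]
  exact (smul_right_injective _ c.ne_zero).eq_iff

lemma mul_apply_smul (χ χ' : G →* kˣ) (g : G) {X Y : C} (a : X ⟶ Y) :
    ((χ * χ') g : k) • a = (χ g : k) • (χ' g : k) • a := by
  simp [smul_smul]

lemma apply_smul_inv_apply_smul (χ : G →* kˣ) (g : G) {X Y : C} (a : X ⟶ Y) :
    (χ g : k) • (χ⁻¹ g : k) • a = a := by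
  simp [smul_smul]

/-- The isomorphism `F_χ F_χ' ≅ F_{χχ'}`, which is the identity on underlying objects. -/
@[simps]
def dualIso (A : LinearAction k G C) (χ χ' : G →* kˣ) (P : EquivariantObject A) :
    (A.dualFunctor χ).obj ((A.dualFunctor χ').obj P) ≅ (A.dualFunctor (χ * χ')).obj P where
  hom :=
    { f := 𝟙 P.X
      comm := fun g => id_comm (F := A.F g) (mul_apply_smul χ χ' g⁻¹ (P.α g).hom) }
  inv :=
    { f := 𝟙 P.X
      comm := fun g => id_comm (F := A.F g) (mul_apply_smul χ χ' g⁻¹ (P.α g).hom).symm }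
  hom_inv_id := by
    ext
    exact Category.id_comp _
  inv_hom_id := by
    ext
    exact Category.id_comp _

instance (A : LinearAction k G C) (χ : G →* kˣ) : (A.dualFunctor χ).IsEquivalence where
  faithful := ⟨fun {_ _ a b} h => by
    have h' := congrArg EquivariantObject.Hom.f h
    exact EquivariantObject.hom_ext h'⟩
  full := ⟨fun {P Q} a =>
    ⟨{ f := a.f, comm := fun g => (smul_comm_iff (F := A.F g) (χ g⁻¹)).1 (a.comm g) }, rfl⟩⟩
  essSurj := ⟨fun Q => ⟨(A.dualFunctor χ⁻¹).obj Q, ⟨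
    { hom :=
        { f := 𝟙 Q.X
          comm := fun g => id_comm (F := A.F g)
            (apply_smul_inv_apply_smul χ g⁻¹ (Q.α g).hom).symm }
      inv :=
        { f := 𝟙 Q.X
          comm := fun g => id_comm (F := A.F g)
            (apply_smul_inv_apply_smul χ g⁻¹ (Q.α g).hom) }
      hom_inv_id := by
        ext
        exact Category.id_comp _
      inv_hom_id := by
        ext
        exact Category.id_comp _ }⟩⟩⟩

/-- The dual action of the character group `Hom(G, kˣ)` on the category of equivariant objects:
`χ` acts by `F_χ`, and the isomorphisms `F_χ F_χ' ≅ F_{χχ'}` are identities on the underlying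
objects. -/
@[simps]
def dual (A : LinearAction k G C) : LinearAction k (G →* kˣ) (EquivariantObject A) where
  F χ := A.dualFunctor χ
  isEquivalence χ := inferInstance
  additive χ := { map_add := rfl }
  linear χ := { map_smul := fun _ _ => rfl }
  ε χ χ' := NatIso.ofComponents (fun P => A.dualIso χ χ' P) (fun {P Q} a => by
    ext
    exact (Category.comp_id a.f).trans (Category.id_comp a.f).symm)
  cocycle χ χ' χ'' P := by
    ext
    simp only [NatIso.ofComponents_hom_app, EquivariantObject.comp_f,
      EquivariantObject.eqToHom_f, dualIso_hom_f, dualFunctor_map_f]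
    refine (Category.id_comp _).trans ((Category.id_comp _).trans ?_)
    exact (Category.id_comp (𝟙 P.X)).symm

end LinearAction

/-! ### Equivariantization -/

namespace EquivariantAutoequivalence

variable {A : LinearAction k G C}

/-- The endofunctor `(F, δ)^G` of the category of equivariant objects, sending `(X, α)` to
`(F X, (δ_g)_X ∘ F(α_g))` and `f` to `F f`. -/
@[simps]
def equivariantFunctor (E : EquivariantAutoequivalence A) :
    EquivariantObject A ⥤ EquivariantObject A where
  obj P :=
    { X := E.F.obj P.X
      α := fun g => E.F.mapIso (P.α g) ≪≫ (E.δ g).app P.X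
      rel := fun g h => by
        have h1 : E.F.map ((A.F g).map (P.α h).hom) ≫ (E.δ g).hom.app ((A.F h).obj P.X) =
            (E.δ g).hom.app P.X ≫ (A.F g).map (E.F.map (P.α h).hom) :=
          (E.δ g).hom.naturality (P.α h).hom
        have h2 := E.compat g h P.X
        simp only [Functor.comp_obj, Iso.trans_hom, Functor.mapIso_hom, Iso.app_hom, P.rel,
          Functor.map_comp, Category.assoc] at *
        rw [h2, reassoc_of% h1] }
  map {P Q} a :=
    { f := E.F.map a.f
      comm := fun g => by
        have h1 : E.F.map ((A.F g).map a.f) ≫ (E.δ g).hom.app Q.X =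
            (E.δ g).hom.app P.X ≫ (A.F g).map (E.F.map a.f) :=
          (E.δ g).hom.naturality a.f
        simp only [Functor.comp_obj, Iso.trans_hom, Functor.mapIso_hom, Iso.app_hom,
          Category.assoc] at *
        rw [← h1, ← Functor.map_comp_assoc, a.comm, Functor.map_comp_assoc] }

instance (E : EquivariantAutoequivalence A) : E.equivariantFunctor.Additive where
  map_add {P Q a b} := by
    ext
    exact E.F.map_add

instance (E : EquivariantAutoequivalence A) : E.equivariantFunctor.Linear k where
  map_smul {P Q} a c := by
    ext
    exact Functor.Linear.map_smul a.f c

instance (E : EquivariantAutoequivalence A) : E.equivariantFunctor.Faithful where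
  map_injective {P Q a b} h := by
    ext
    exact E.F.map_injective (congrArg (fun c => EquivariantObject.Hom.f c) h)

/-- The natural isomorphism `(F, δ)^G ≅ (F', δ')^G` given by an isomorphism
`(F, δ) ≅ (F', δ')`. -/
def equivariantFunctorIso {E E' : EquivariantAutoequivalence A} (φ : E.F ≅ E'.F)
    (hφ : ∀ (g : G) (X : C), (E.δ g).hom.app X ≫ (A.F g).map (φ.hom.app X) =
      φ.hom.app ((A.F g).obj X) ≫ (E'.δ g).hom.app X) :
    E.equivariantFunctor ≅ E'.equivariantFunctor :=
  NatIso.ofComponents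
    (fun P => EquivariantObject.isoMk (φ.app P.X) (fun g => by
      have h1 := φ.hom.naturality (P.α g).hom
      have h2 := hφ g P.X
      have h3 : φ.hom.app P.X ≫ E'.F.map (P.α g).hom ≫ (E'.δ g).hom.app P.X =
          (E.F.map (P.α g).hom ≫ (E.δ g).hom.app P.X) ≫ (A.F g).map (φ.hom.app P.X) := by
        rw [Category.assoc, h2, reassoc_of% h1]
      exact h3))
    (fun {P Q} a => by
      ext
      exact φ.hom.naturality a.f)

instance (E : EquivariantAutoequivalence A) : E.equivariantFunctor.Full where
  map_surjective {P Q} b := by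
    have hb : E.F.map (E.F.preimage b.f) = b.f := E.F.map_preimage b.f
    refine ⟨{ f := E.F.preimage b.f, comm := fun g => ?_ }, ?_⟩
    · apply E.F.map_injective
      have h1 : b.f ≫ E.F.map (Q.α g).hom ≫ (E.δ g).hom.app Q.X =
          (E.F.map (P.α g).hom ≫ (E.δ g).hom.app P.X) ≫ (A.F g).map b.f := b.comm g
      rw [← hb] at h1
      have h2 : E.F.map ((A.F g).map (E.F.preimage b.f)) ≫ (E.δ g).hom.app Q.X =
          (E.δ g).hom.app P.X ≫ (A.F g).map (E.F.map (E.F.preimage b.f)) :=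
        (E.δ g).hom.naturality (E.F.preimage b.f)
      rw [← cancel_mono ((E.δ g).hom.app Q.X)]
      rw [Functor.map_comp, Functor.map_comp, Category.assoc, Category.assoc, h2]
      exact h1.trans (Category.assoc _ _ _)
    · ext
      exact hb

instance (E : EquivariantAutoequivalence A) : E.equivariantFunctor.EssSurj where
  mem_essImage Q := by
    refine ⟨E.inverse.equivariantFunctor.obj Q,
      ⟨EquivariantObject.isoMk (E.cIso Q.X) (fun g => ?_)⟩⟩
    have h1 := E.counit_naturality (Q.α g).hom
    have h2 := E.map_inverseδApp g Q.X
    have h3 : (E.cIso Q.X).hom ≫ (Q.α g).hom =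
        (E.F.map (E.F.inv.map (Q.α g).hom ≫ (E.inverseδApp g Q.X).hom) ≫
          (E.δ g).hom.app (E.F.inv.obj Q.X)) ≫ (A.F g).map (E.cIso Q.X).hom := by
      have h4 : (A.F g).map (E.cIso Q.X).inv ≫ (A.F g).map (E.cIso Q.X).hom = 𝟙 _ := by
        rw [← Functor.map_comp, Iso.inv_hom_id, CategoryTheory.Functor.map_id]
      rw [← h1, Functor.map_comp, h2]
      simp only [Category.assoc, Iso.inv_hom_id_app_assoc, Functor.comp_obj]
      rw [h4, Category.comp_id]
    exact h3

instance (E : EquivariantAutoequivalence A) : E.equivariantFunctor.IsEquivalence where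

lemma smul_structure (E : EquivariantAutoequivalence A) (c : k) (g : G) {X : C}
    (a : X ⟶ (A.F g).obj X) :
    c • (E.F.map a ≫ (E.δ g).hom.app X) = E.F.map (c • a) ≫ (E.δ g).hom.app X := by
  rw [Functor.map_smul, Linear.smul_comp]

/-- `(F, δ)^G` as a `Ĝ`-equivariant autoequivalence for the dual action; the isomorphisms
`(F, δ)^G F_χ ≅ F_χ (F, δ)^G` are identities on the underlying objects. -/
def equivariantization (E : EquivariantAutoequivalence A) :
    EquivariantAutoequivalence A.dual where
  F := E.equivariantFunctor
  isEquivalence := inferInstance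
  additive := inferInstance
  linear := inferInstance
  δ χ := NatIso.ofComponents
    (fun P =>
      { hom := { f := 𝟙 (E.F.obj P.X)
                 comm := fun g => id_comm (F := A.F g)
                   (E.smul_structure (χ g⁻¹ : k) g (P.α g).hom) }
        inv := { f := 𝟙 (E.F.obj P.X)
                 comm := fun g => id_comm (F := A.F g)
                   (E.smul_structure (χ g⁻¹ : k) g (P.α g).hom).symm }
        hom_inv_id := by
          ext
          exact Category.id_comp _
        inv_hom_id := by
          ext
          exact Category.id_comp _ })
    (fun {P Q} a => by
      ext
      exact (Category.comp_id (E.F.map a.f)).trans (Category.id_comp (E.F.map a.f)).symm)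
  compat χ χ' P := by
    ext
    have h : E.F.map (𝟙 P.X) = 𝟙 (E.F.obj P.X) := E.F.map_id P.X
    exact (Category.comp_id _).trans (h.trans
      ((Category.id_comp (𝟙 (E.F.obj P.X) ≫ 𝟙 (E.F.obj P.X))).trans
        (Category.id_comp (𝟙 (E.F.obj P.X)))).symm)

/-- Isomorphic equivariant autoequivalences have isomorphic equivariantizations. -/
lemma Isomorphic.equivariantization {E E' : EquivariantAutoequivalence A}
    (h : E.Isomorphic E') : E.equivariantization.Isomorphic E'.equivariantization := by
  obtain ⟨φ, hφ⟩ := h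
  refine ⟨equivariantFunctorIso φ hφ, fun χ P => ?_⟩
  ext
  exact (Category.id_comp (φ.hom.app P.X)).trans (Category.comp_id (φ.hom.app P.X)).symm

lemma equivariantization_comp_aux (E E' : EquivariantAutoequivalence A)
    (P : EquivariantObject A) (g : G) :
    E.F.map (E'.F.map (P.α g).hom ≫ (E'.δ g).hom.app P.X) ≫ (E.δ g).hom.app (E'.F.obj P.X) =
      E.F.map (E'.F.map (P.α g).hom) ≫ ((E.comp E').δ g).hom.app P.X := by
  simp [comp]

lemma equivariantization_comp (E E' : EquivariantAutoequivalence A) :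
    (E.comp E').equivariantization.Isomorphic
      (E.equivariantization.comp E'.equivariantization) := by
  refine ⟨NatIso.ofComponents
    (fun P =>
      { hom := { f := 𝟙 (E.F.obj (E'.F.obj P.X))
                 comm := fun g => id_comm (F := A.F g) (equivariantization_comp_aux E E' P g) }
        inv := { f := 𝟙 (E.F.obj (E'.F.obj P.X))
                 comm := fun g => id_comm (F := A.F g)
                   (equivariantization_comp_aux E E' P g).symm }
        hom_inv_id := by
          ext
          exact Category.id_comp _
        inv_hom_id := by
          ext
          exact Category.id_comp _ })
    (fun {P Q} a => by
      ext
      exact (Category.comp_id (E.F.map (E'.F.map a.f))).trans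
        (Category.id_comp (E.F.map (E'.F.map a.f))).symm), fun χ P => ?_⟩
  ext
  have h : E.F.map (𝟙 (E'.F.obj P.X)) = 𝟙 (E.F.obj (E'.F.obj P.X)) := E.F.map_id _
  refine congrArg (𝟙 (E.F.obj (E'.F.obj P.X)) ≫ ·) ?_
  exact (Eq.trans (congrArg (· ≫ 𝟙 (E.F.obj (E'.F.obj P.X))) h) (Category.id_comp _)).symm

end EquivariantAutoequivalence

/-- The equivariantization homomorphism `(-)^G : Aut(C; G) → Aut(C^G; Ĝ)`,
`[F, δ] ↦ [(F, δ)^G]`. -/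
noncomputable def equivariantizationHom (A : LinearAction k G C) :
    A.AutGroup →* A.dual.AutGroup :=
  MonoidHom.mk'
    (Quotient.map EquivariantAutoequivalence.equivariantization
      (fun _ _ h => EquivariantAutoequivalence.Isomorphic.equivariantization h))
    (fun x y => by
      obtain ⟨E, rfl⟩ := LinearAction.cls_surjective x
      obtain ⟨E', rfl⟩ := LinearAction.cls_surjective y
      exact LinearAction.cls_eq_cls.2
        (EquivariantAutoequivalence.equivariantization_comp E E'))

lemma equivariantizationHom_cls {A : LinearAction k G C} (E : EquivariantAutoequivalence A) :
    equivariantizationHom A (LinearAction.cls E) = LinearAction.cls E.equivariantization := rfl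

/-- `G` splits over `k`: the group algebra `kG` is isomorphic to a finite product of copies
of `k`. -/
def SplitsOver (k : Type w) [Field k] (G : Type x) [Group G] : Prop :=
  ∃ n : ℕ, Nonempty (MonoidAlgebra k G ≃ₐ[k] (Fin n → k))

/-- `Z(C) = k`: the structure map from `k` to the center of `C` (the natural endomorphisms of
the identity functor) is bijective. -/
def CenterEqScalars (k : Type w) [Field k] (C : Type u) [Category.{v} C] [Preadditive C]
    [Linear k C] : Prop :=
  Function.Bijective (Linear.toCatCenter k C)

end
end Equivariantization

/-! Under `Z(C) = k` every class in `Act(C; G)` has a simple model. Since `G` is abelian, `F_a`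
carries a canonical equivariant structure `c_{a,g} : F_a F_g ≅ F_{ag} = F_{ga} ≅ F_g F_a`. Any other
structure on `F_a` differs from it by natural automorphisms of `F_g F_a`, hence by scalars, and the
coherence condition forces these scalars to form a character. So each class is that of some
`twistedTranslation a χ` (`CenterEqScalars.exists_isomorphic_twistedTranslation`), and the same
applies to the dual action when `Z(C^G) = k`.

For an equivariant object `(X, α)`, the map `α_a⁻¹ : F_a X → X` identifies the equivariantization of
the model `(a, χ)` with the model `(χ⁻¹, ev_{a⁻¹})` of the dual action
(`twistedTranslation_equivariantization`). Hence `Act` maps into `Act`. Surjectivity follows because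
splitting makes `G` its own double dual (`SplitsOver.exists_eval_eq`).

Injectivity holds on all of `Aut(C; G)`. Let `Φ : (F, δ)^G ≅ Id` be compatible with the dual action.
At the induced object `⨁_g F_g X`, `Φ` commutes with the endomorphism acting on `F_g X` by `χ(g)`.
Characters separate the elements of `G`, so `Φ` is diagonal there. Its entry at `F_1 X` descends, by
full faithfulness of `F_1`, to an isomorphism `F X ≅ X`. Naturality and equivariance of `Φ` make it
an isomorphism `(F, δ) ≅ Id`. -/

namespace Equivariantization

/-! ### Characters of a split group -/

section Characters

variable {k : Type*} [Field k] {G : Type*}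

/-- Distinct group elements are distinct in `kG ≅ k^n`, so some coordinate separates them; each
coordinate is multiplicative and takes unit values on `G`. -/
lemma SplitsOver.exists_character_ne [Group G] (hG : SplitsOver k G) {g h : G} (hgh : g ≠ h) :
    ∃ χ : G →* kˣ, χ g ≠ χ h := by
  obtain ⟨n, ⟨φ⟩⟩ := hG
  have h1 : φ (MonoidAlgebra.of k G g) ≠ φ (MonoidAlgebra.of k G h) :=
    fun h => hgh (MonoidAlgebra.of_injective (φ.injective h))
  obtain ⟨i, hi⟩ := Function.ne_iff.1 h1
  let ψ : G →* k :=
    ((Pi.evalMonoidHom (fun _ : Fin n => k) i).comp (φ : MonoidAlgebra k G →* (Fin n → k))).comp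
      (MonoidAlgebra.of k G)
  refine ⟨ψ.toHomUnits, fun h => hi ?_⟩
  exact congrArg Units.val h

/-- Dedekind independence: characters are linearly independent in the space of functions `G → k`,
which has dimension `|G|`. -/
lemma finite_and_card_characters_le [Group G] [Finite G] :
    Finite (G →* kˣ) ∧ Nat.card (G →* kˣ) ≤ Nat.card G := by
  have := Fintype.ofFinite G
  have h : LinearIndependent k (fun χ : G →* kˣ => ((fun g => (χ g : k)) : G → k)) :=
    (linearIndependent_monoidHom G k).comp (fun χ : G →* kˣ => (Units.coeHom k).comp χ)
      (fun χ ψ h => by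
        ext g
        exact DFunLike.congr_fun h g)
  have hfin : Finite (G →* kˣ) := h.finite
  refine ⟨hfin, ?_⟩
  have := Fintype.ofFinite (G →* kˣ)
  simpa [Nat.card_eq_fintype_card] using h.fintype_card_le_finrank

/-- Evaluation from `G` to its double dual is injective by separation; the cardinality bound,
applied to `G` and to its character group, makes it bijective. -/
lemma SplitsOver.exists_eval_eq [CommGroup G] [Finite G] (hG : SplitsOver k G)
    (l : (G →* kˣ) →* kˣ) : ∃ a : G, ∀ χ : G →* kˣ, l χ = χ a := by
  obtain ⟨h1, h2⟩ := finite_and_card_characters_le (k := k) (G := G)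
  obtain ⟨h3, h4⟩ := finite_and_card_characters_le (k := k) (G := G →* kˣ)
  have hinj : Function.Injective (MonoidHom.eval : G →* (G →* kˣ) →* kˣ) := by
    intro g h hgh
    by_contra hne
    obtain ⟨χ, hχ⟩ := hG.exists_character_ne hne
    exact hχ (DFunLike.congr_fun hgh χ)
  have hbij := (Nat.bijective_iff_injective_and_card _).2
    ⟨hinj, (Nat.card_le_card_of_injective _ hinj).antisymm (h4.trans h2)⟩
  obtain ⟨a, rfl⟩ := hbij.surjective l
  exact ⟨a, fun χ => rfl⟩

end Characters

universe w x v u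

variable {k : Type w} [Field k] {C : Type u} [Category.{v} C] [Preadditive C] [Linear k C]

/-! ### Scalars -/

lemma CenterEqScalars.smul_id_injective (hC : CenterEqScalars k C) {c d : k}
    (h : ∀ X : C, c • 𝟙 X = d • 𝟙 X) : c = d :=
  hC.1 (CatCenter.ext _ _ h)

/-- If `Z(C) = k`, then every natural automorphism of a `k`-linear equivalence is a scalar. -/
lemma CenterEqScalars.exists_unit_smul_id (hC : CenterEqScalars k C) (F : C ⥤ C)
    [F.IsEquivalence] [F.Additive] [F.Linear k] (φ : F ≅ F) :
    ∃ c : kˣ, ∀ X, φ.hom.app X = (c : k) • 𝟙 (F.obj X) := by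
  have key : ∀ ψ : F ⟶ F, ∃ c : k, ∀ X, ψ.app X = c • 𝟙 (F.obj X) := by
    intro ψ
    -- Full faithfulness of `F` pulls `ψ` back to a natural endomorphism of the identity, which is a
    -- scalar.
    obtain ⟨c, hc⟩ := hC.2
      { app := fun X => F.preimage (ψ.app X)
        naturality := fun X Y f => F.map_injective (by simp) }
    refine ⟨c, fun X => ?_⟩
    have h : c • 𝟙 X = F.preimage (ψ.app X) := congrArg (fun z => CatCenter.app z X) hc
    rw [← F.map_preimage (ψ.app X), ← h, F.map_smul, F.map_id]
  obtain ⟨c, hc⟩ := key φ.hom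
  obtain ⟨d, hd⟩ := key φ.inv
  have hcd : c * d = 1 := hC.smul_id_injective (fun X => F.map_injective (by
    have h := φ.hom_inv_id_app X
    rw [hc, hd, Linear.smul_comp, Category.id_comp, smul_smul] at h
    rw [F.map_smul, F.map_smul, F.map_id, h, one_smul]))
  exact ⟨Units.mkOfMulEqOne c d hcd, hc⟩

/-! ### Multiplication isomorphisms -/

section

variable {G : Type x} [Group G]

namespace LinearAction

variable (A : LinearAction k G C)

/-- The component at `X` of the isomorphism `F_g F_h ≅ F_m` for `g * h = m`. -/
def mulIsoApp {g h m : G} (e : g * h = m) (X : C) :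
    (A.F g).obj ((A.F h).obj X) ≅ (A.F m).obj X :=
  (A.ε g h).app X ≪≫ eqToIso (congrArg (fun a => (A.F a).obj X) e)

lemma mulIsoApp_rfl_hom (g h : G) (X : C) :
    (A.mulIsoApp (rfl : g * h = _) X).hom = (A.ε g h).hom.app X := by
  simp [mulIsoApp]

lemma mulIsoApp_naturality {g h m : G} (e : g * h = m) {X Y : C} (f : X ⟶ Y) :
    (A.F g).map ((A.F h).map f) ≫ (A.mulIsoApp e Y).hom =
      (A.mulIsoApp e X).hom ≫ (A.F m).map f := by
  subst e
  simp only [mulIsoApp_rfl_hom]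
  exact (A.ε g h).hom.naturality f

/-- The 2-cocycle condition with free product indices, so that no transport along associativity
appears. -/
lemma mulIsoApp_assoc {g h l m p n : G} (e₁ : g * h = m) (e₂ : m * l = n) (e₃ : h * l = p)
    (e₄ : g * p = n) (X : C) :
    (A.mulIsoApp e₁ ((A.F l).obj X)).hom ≫ (A.mulIsoApp e₂ X).hom =
      (A.F g).map (A.mulIsoApp e₃ X).hom ≫ (A.mulIsoApp e₄ X).hom := by
  subst e₁ e₃ e₄
  have h := A.cocycle g h l X
  simp only [mulIsoApp_rfl_hom]
  rw [← h]
  simp [mulIsoApp]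

end LinearAction

lemma EquivariantObject.α_mul {A : LinearAction k G C} (P : EquivariantObject A) {g h m : G}
    (e : g * h = m) :
    (P.α g).hom ≫ (A.F g).map (P.α h).hom ≫ (A.mulIsoApp e P.X).hom = (P.α m).hom := by
  subst e
  rw [A.mulIsoApp_rfl_hom, P.rel]

lemma EquivariantObject.mulIsoApp_α_inv_α {A : LinearAction k G C} (P : EquivariantObject A)
    {g h m : G} (e : g * h = m) :
    (A.mulIsoApp e P.X).hom ≫ (P.α m).inv ≫ (P.α g).hom = (A.F g).map (P.α h).inv := by
  rw [← cancel_mono ((A.F g).map (P.α h).hom ≫ (A.mulIsoApp e P.X).hom)]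
  simp only [Category.assoc]
  rw [P.α_mul, Iso.inv_hom_id, Category.comp_id, ← Functor.map_comp_assoc, Iso.inv_hom_id,
    CategoryTheory.Functor.map_id, Category.id_comp]

namespace EquivariantAutoequivalence

variable {A : LinearAction k G C} (E : EquivariantAutoequivalence A)

/-- The component at `X` of `δ_g`. -/
def δApp (g : G) (X : C) : E.F.obj ((A.F g).obj X) ≅ (A.F g).obj (E.F.obj X) :=
  (E.δ g).app X

lemma δApp_naturality (g : G) {X Y : C} (f : X ⟶ Y) :
    E.F.map ((A.F g).map f) ≫ (E.δApp g Y).hom = (E.δApp g X).hom ≫ (A.F g).map (E.F.map f) :=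
  (E.δ g).hom.naturality f

lemma map_mulIsoApp_δApp {g h m : G} (e : g * h = m) (X : C) :
    E.F.map (A.mulIsoApp e X).hom ≫ (E.δApp m X).hom =
      (E.δApp g ((A.F h).obj X)).hom ≫ (A.F g).map (E.δApp h X).hom ≫
        (A.mulIsoApp e (E.F.obj X)).hom := by
  subst e
  simp only [A.mulIsoApp_rfl_hom]
  exact E.compat g h X

end EquivariantAutoequivalence

end

end Equivariantization

namespace Equivariantization

universe w x v u

variable {k : Type w} [Field k] {C : Type u} [Category.{v} C] [Preadditive C] [Linear k C]

/-! ### The equivariant autoequivalences attached to a group element and a character -/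

section

variable {G : Type x} [CommGroup G]

namespace LinearAction

variable (A : LinearAction k G C)

/-- The canonical isomorphism `F_a F_g ≅ F_{ag} = F_{ga} ≅ F_g F_a`. -/
def commIsoApp (a g : G) (X : C) :
    (A.F a).obj ((A.F g).obj X) ≅ (A.F g).obj ((A.F a).obj X) :=
  A.mulIsoApp rfl X ≪≫ (A.mulIsoApp (mul_comm g a) X).symm

/-- Characterizes `c_{a,g}`: it becomes trivial once both sides are identified with `F_{ag}`. Later
identities are checked after such a composition. -/
lemma commIsoApp_hom_comp_mulIsoApp {a g m : G} (e : g * a = m) (e' : a * g = m) (X : C) :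
    (A.commIsoApp a g X).hom ≫ (A.mulIsoApp e X).hom = (A.mulIsoApp e' X).hom := by
  subst e'
  simp [commIsoApp]

lemma commIsoApp_naturality (a g : G) {X Y : C} (f : X ⟶ Y) :
    (A.F a).map ((A.F g).map f) ≫ (A.commIsoApp a g Y).hom =
      (A.commIsoApp a g X).hom ≫ (A.F g).map ((A.F a).map f) := by
  rw [← cancel_mono (A.mulIsoApp (rfl : g * a = _) Y).hom, Category.assoc, Category.assoc,
    A.commIsoApp_hom_comp_mulIsoApp rfl (mul_comm a g), A.mulIsoApp_naturality,
    A.mulIsoApp_naturality, reassoc_of% (A.commIsoApp_hom_comp_mulIsoApp rfl (mul_comm a g))]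

lemma map_mulIsoApp_commIsoApp (a : G) {g h m : G} (e : g * h = m) (X : C) :
    (A.F a).map (A.mulIsoApp e X).hom ≫ (A.commIsoApp a m X).hom =
      (A.commIsoApp a g ((A.F h).obj X)).hom ≫ (A.F g).map (A.commIsoApp a h X).hom ≫
        (A.mulIsoApp e ((A.F a).obj X)).hom := by
  have e₂ : g * (a * h) = a * m := by rw [← e, mul_left_comm]
  -- Followed by `F_m F_a ≅ F_{am}`, both sides become the canonical map `F_a F_g F_h X → F_{agh}
  -- X`.
  rw [← cancel_mono (A.mulIsoApp (mul_comm m a) X).hom]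
  simp only [Category.assoc]
  rw [A.commIsoApp_hom_comp_mulIsoApp _ rfl, A.mulIsoApp_assoc e (mul_comm m a) (mul_comm h a) e₂,
    ← Functor.map_comp_assoc, A.commIsoApp_hom_comp_mulIsoApp _ rfl,
    ← A.mulIsoApp_assoc (mul_comm g a) (by rw [mul_assoc, e]) rfl e₂,
    reassoc_of% (A.commIsoApp_hom_comp_mulIsoApp _ rfl), A.mulIsoApp_assoc _ _ e]

/-- The `k`-linear equivariant autoequivalence `F_a` with the structure `χ(g) c_{a,g}`, where
`c_{a,g} : F_a F_g ≅ F_g F_a` is the canonical isomorphism. -/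
def twistedTranslation (a : G) (χ : G →* kˣ) : EquivariantAutoequivalence A where
  F := A.F a
  isEquivalence := inferInstance
  additive := inferInstance
  linear := inferInstance
  δ g := NatIso.ofComponents (fun X =>
      { hom := (χ g : k) • (A.commIsoApp a g X).hom
        inv := (χ g⁻¹ : k) • (A.commIsoApp a g X).inv
        hom_inv_id := by simp [smul_smul]
        inv_hom_id := by simp [smul_smul] })
    (fun {X Y} f => by
      have h := A.commIsoApp_naturality a g f
      dsimp only [Functor.comp_map, Functor.comp_obj]
      rw [Linear.comp_smul, Linear.smul_comp, h])
  compat g h X := by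
    have h := A.map_mulIsoApp_commIsoApp a (rfl : g * h = _) X
    rw [A.mulIsoApp_rfl_hom, A.mulIsoApp_rfl_hom] at h
    dsimp only [NatIso.ofComponents_hom_app, Functor.comp_obj]
    rw [Linear.comp_smul, h, Functor.map_smul]
    simp only [Linear.smul_comp, Linear.comp_smul, smul_smul, map_mul, Units.val_mul, mul_comm]

lemma twistedTranslation_mem_act (a : G) (χ : G →* kˣ) : cls (A.twistedTranslation a χ) ∈ A.act :=
  (cls_mem_act_iff _).2 ⟨a, ⟨Iso.refl _⟩⟩

end LinearAction

/-- If `Z(C) = k`, then an equivariant autoequivalence whose functor is isomorphic to `F_a` is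
isomorphic to `F_a` with its canonical structure twisted by a character. -/
lemma CenterEqScalars.exists_isomorphic_twistedTranslation (hC : CenterEqScalars k C)
    {A : LinearAction k G C} (E : EquivariantAutoequivalence A) {a : G} (ψ : E.F ≅ A.F a) :
    ∃ χ : G →* kˣ, E.Isomorphic (A.twistedTranslation a χ) := by
  have h1 : ∀ g : G, ∃ c : kˣ, ∀ X : C, (E.δApp g X).hom ≫ (A.F g).map (ψ.hom.app X) =
      ψ.hom.app ((A.F g).obj X) ≫ ((c : k) • (A.commIsoApp a g X).hom) := by
    intro g
    -- The discrepancy between `δ_g`, transported along `ψ`, and `c_{a,g}`: an automorphism of `F_g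
    -- F_a`, hence a scalar.
    let φ : A.F a ⋙ A.F g ≅ A.F a ⋙ A.F g := NatIso.ofComponents
      (fun X => (A.commIsoApp a g X).symm ≪≫ (ψ.app ((A.F g).obj X)).symm ≪≫ E.δApp g X ≪≫
        (A.F g).mapIso (ψ.app X))
      (fun {X Y} f => by
        have h2 := ψ.inv.naturality ((A.F g).map f)
        have h3 := ψ.hom.naturality f
        simp only [Iso.trans_hom, Iso.symm_hom, Iso.app_inv, Functor.comp_map,
          Functor.mapIso_hom, Iso.app_hom]
        rw [← cancel_epi (A.commIsoApp a g X).hom, ← reassoc_of% A.commIsoApp_naturality]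
        simp only [Iso.hom_inv_id_assoc, Category.assoc]
        rw [reassoc_of% h2, reassoc_of% E.δApp_naturality, ← Functor.map_comp, ← Functor.map_comp,
          h3])
    obtain ⟨c, hc⟩ := hC.exists_unit_smul_id _ φ
    refine ⟨c, fun X => ?_⟩
    have h4 : (A.commIsoApp a g X).inv ≫ ψ.inv.app ((A.F g).obj X) ≫ (E.δApp g X).hom ≫
        (A.F g).map (ψ.hom.app X) = (c : k) • 𝟙 _ := hc X
    rw [Iso.inv_comp_eq, ← Iso.app_inv, Iso.inv_comp_eq, Linear.comp_smul] at h4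
    rw [h4]
    simp
  choose c hc using h1
  refine ⟨MonoidHom.mk' c (fun g h => ?_), ψ, fun g X => hc g X⟩
  refine Units.ext (hC.smul_id_injective fun X => ?_)
  -- Multiplicativity of `c`: the coherence of `δ`, rewritten through `ψ`, is compared with that of
  -- the canonical structure. The same isomorphism appears on both sides, once with factor `c(gh)`
  -- and once with `c(g)c(h)`.
  have h2 := congrArg (· ≫ (A.F (g * h)).map (ψ.hom.app X))
    (E.map_mulIsoApp_δApp (rfl : g * h = _) X)
  simp only [Category.assoc] at h2
  have h3 := ψ.hom.naturality ((A.mulIsoApp (rfl : g * h = _) X).hom)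
  have h4 := ψ.hom.naturality ((A.commIsoApp a h X).hom)
  rw [hc, reassoc_of% h3, ← A.mulIsoApp_naturality, ← Functor.map_comp_assoc, hc,
    Functor.map_comp_assoc, reassoc_of% (hc g ((A.F h).obj X)), Linear.comp_smul,
    A.map_mulIsoApp_commIsoApp, Functor.map_smul] at h2
  simp only [Linear.smul_comp, Linear.comp_smul, smul_smul] at h2
  have h5 : IsIso (ψ.hom.app ((A.F g).obj ((A.F h).obj X)) ≫
      (A.commIsoApp a g ((A.F h).obj X)).hom ≫ (A.F g).map (A.commIsoApp a h X).hom ≫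
        (A.mulIsoApp (rfl : g * h = _) ((A.F a).obj X)).hom) := inferInstance
  generalize ψ.hom.app ((A.F g).obj ((A.F h).obj X)) ≫
      (A.commIsoApp a g ((A.F h).obj X)).hom ≫ (A.F g).map (A.commIsoApp a h X).hom ≫
        (A.mulIsoApp (rfl : g * h = _) ((A.F a).obj X)).hom = f at h2 h5
  have h6 := congrArg (· ≫ inv f) h2
  simp only [Linear.smul_comp, IsIso.hom_inv_id] at h6
  refine (A.F h ⋙ A.F g ⋙ E.F).map_injective ?_
  simpa [Functor.map_smul, mul_comm (c h : k)] using h6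

end

/-! ### Equivariantization of twisted translations -/

section

variable {G : Type x} [CommGroup G] {A : LinearAction k G C}

lemma dual_mulIsoApp_hom_f {χ η ψ : G →* kˣ} (e : χ * η = ψ) (P : EquivariantObject A) :
    (A.dual.mulIsoApp e P).hom.f = 𝟙 P.X := by
  subst e
  rw [A.dual.mulIsoApp_rfl_hom]
  rfl

lemma dual_commIsoApp_hom_f (χ η : G →* kˣ) (P : EquivariantObject A) :
    (A.dual.commIsoApp χ η P).hom.f = 𝟙 P.X := by
  have h := congrArg EquivariantObject.Hom.f
    (A.dual.commIsoApp_hom_comp_mulIsoApp (mul_comm η χ) rfl P)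
  rw [EquivariantObject.comp_f, dual_mulIsoApp_hom_f, dual_mulIsoApp_hom_f] at h
  exact (Category.comp_id _).symm.trans h

/-- Says that `α_a` is an equivariant morphism from `P` to its image under `(F_a, c_{a,-})^G`. Both
sides become `α_{ag}` in `F_{ag} X`, as `ag = ga`. -/
lemma EquivariantObject.map_α_comp_commIsoApp (P : EquivariantObject A) (a g : G) :
    (P.α a).hom ≫ (A.F a).map (P.α g).hom ≫ (A.commIsoApp a g P.X).hom =
      (P.α g).hom ≫ (A.F g).map (P.α a).hom := by
  rw [← cancel_mono (A.mulIsoApp (mul_comm g a) P.X).hom]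
  simp only [Category.assoc]
  rw [A.commIsoApp_hom_comp_mulIsoApp _ rfl, P.α_mul, P.α_mul]

/-- The equivariantization of `F_a` twisted by `χ` is `F_{χ⁻¹}` twisted by evaluation at `a⁻¹`. -/
lemma twistedTranslation_equivariantization (a : G) (χ : G →* kˣ) :
    (A.twistedTranslation a χ).equivariantization.Isomorphic
      (A.dual.twistedTranslation χ⁻¹ (MonoidHom.eval a⁻¹)) := by
  refine ⟨NatIso.ofComponents (fun P => EquivariantObject.isoMk (P.α a).symm (fun g => ?_))
    (fun {P Q} f => ?_), fun η P => ?_⟩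
  · have h := P.map_α_comp_commIsoApp a g
    -- The factor `χ(g)` in the structure of the source is exactly the factor `χ⁻¹(g⁻¹)` by which
    -- `F_{χ⁻¹}` twists `α_g`.
    change (P.α a).inv ≫ (((χ⁻¹ g⁻¹ : kˣ) : k) • (P.α g).hom) =
      ((A.F a).map (P.α g).hom ≫ ((χ g : k) • (A.commIsoApp a g P.X).hom)) ≫
        (A.F g).map (P.α a).inv
    rw [Iso.inv_comp_eq, Linear.comp_smul, Linear.smul_comp, Linear.comp_smul, Category.assoc,
      reassoc_of% h, ← Functor.map_comp]
    simp
  · ext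
    change (A.F a).map f.f ≫ (Q.α a).inv = (P.α a).inv ≫ f.f
    rw [Iso.comp_inv_eq, Category.assoc, f.comm, Iso.inv_hom_id_assoc]
  · ext
    -- On `F_η P` the map `α_a` is scaled by `η(a⁻¹)`, so its inverse is scaled by `η(a)`;
    -- evaluation at `a⁻¹` cancels this.
    change 𝟙 _ ≫ (P.α a).inv = ((η a : k) • (P.α a).inv) ≫
      ((η a⁻¹ : k) • (A.dual.commIsoApp χ⁻¹ η P).hom).f
    rw [EquivariantObject.smul_f, dual_commIsoApp_hom_f]
    refine (Category.id_comp _).trans (Eq.symm ((Linear.comp_smul _ _ _ _ _ _).trans ?_))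
    refine (congrArg _ (Category.comp_id _)).trans ?_
    rw [map_inv, Units.val_inv_eq_inv_val]
    exact inv_smul_smul₀ (η a).ne_zero _

end

end Equivariantization

namespace Equivariantization

universe w x v u

variable {k : Type w} [Field k] {C : Type u} [Category.{v} C] [Preadditive C] [Linear k C]
  [HasFiniteBiproducts C] {G : Type x} [Group G] [Finite G] (A : LinearAction k G C)

/-! ### Induced equivariant objects -/

namespace LinearAction

/-- The underlying object `⨁_g F_g X` of the induced equivariant object. -/
noncomputable abbrev indObj (X : C) : C := ⨁ fun g : G => (A.F g).obj X

/-- The inclusion of `F_g X` into `⨁_g F_g X`. -/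
noncomputable abbrev indι (X : C) (g : G) : (A.F g).obj X ⟶ A.indObj X :=
  biproduct.ι (fun g : G => (A.F g).obj X) g

/-- The projection of `⨁_g F_g X` to `F_g X`. -/
noncomputable abbrev indπ (X : C) (g : G) : A.indObj X ⟶ (A.F g).obj X :=
  biproduct.π (fun g : G => (A.F g).obj X) g

variable {A}

lemma ind_hom_ext {X Y : C} {f f' : A.indObj X ⟶ Y}
    (h : ∀ g, A.indι X g ≫ f = A.indι X g ≫ f') : f = f' :=
  biproduct.hom_ext' _ _ h

lemma sum_indπ_comp_indι [Fintype G] (X : C) : ∑ g : G, A.indπ X g ≫ A.indι X g = 𝟙 _ :=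
  ind_hom_ext fun g => by
    classical
    rw [Preadditive.comp_sum, Finset.sum_eq_single g]
    · rw [biproduct.ι_π_self_assoc, Category.comp_id]
    · intro h _ hg
      rw [biproduct.ι_π_ne_assoc _ hg.symm, zero_comp]
    · simp

/-- An additive functor preserves the decomposition of `⨁_g F_g X`. -/
lemma map_ind_hom_ext (F : C ⥤ C) [F.Additive] {X Y : C} {f f' : F.obj (A.indObj X) ⟶ Y}
    (h : ∀ g, F.map (A.indι X g) ≫ f = F.map (A.indι X g) ≫ f') : f = f' := by
  have := Fintype.ofFinite G
  have h1 : ∑ g : G, F.map (A.indπ X g) ≫ F.map (A.indι X g) = 𝟙 _ := by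
    simp only [← Functor.map_comp, ← Functor.map_sum]
    rw [sum_indπ_comp_indι, F.map_id]
  rw [← Category.id_comp f, ← Category.id_comp f', ← h1, Preadditive.sum_comp,
    Preadditive.sum_comp]
  exact Finset.sum_congr rfl fun g _ => by rw [Category.assoc, h, Category.assoc]

variable (A)

/-- The structure map `⨁_m F_m X ⟶ F_h (⨁_g F_g X)`, identifying `F_{hg} X` with `F_h F_g X`. -/
noncomputable def indα (X : C) (h : G) : A.indObj X ⟶ (A.F h).obj (A.indObj X) :=
  biproduct.desc fun m =>
    (A.mulIsoApp (mul_inv_cancel_left h m) X).inv ≫ (A.F h).map (A.indι X (h⁻¹ * m))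

lemma ι_indα (X : C) {h g m : G} (e : h * g = m) :
    (A.mulIsoApp e X).hom ≫ A.indι X m ≫ A.indα X h = (A.F h).map (A.indι X g) := by
  obtain rfl : g = h⁻¹ * m := by rw [← e, inv_mul_cancel_left]
  simp [indα]

/-- The inverse of `indα`. -/
noncomputable def indαInv (X : C) (h : G) : (A.F h).obj (A.indObj X) ⟶ A.indObj X :=
  haveI := Fintype.ofFinite G
  ∑ g : G, (A.F h).map (A.indπ X g) ≫ (A.mulIsoApp (rfl : h * g = _) X).hom ≫ A.indι X (h * g)

lemma ι_indαInv (X : C) {h g m : G} (e : h * g = m) :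
    (A.F h).map (A.indι X g) ≫ A.indαInv X h = (A.mulIsoApp e X).hom ≫ A.indι X m := by
  classical
  subst e
  have := Fintype.ofFinite G
  rw [indαInv, Preadditive.comp_sum, Finset.sum_eq_single g]
  · rw [← Functor.map_comp_assoc, biproduct.ι_π_self,
      CategoryTheory.Functor.map_id, Category.id_comp]
  · intro g' _ hg
    rw [← Functor.map_comp_assoc, biproduct.ι_π_ne _ hg.symm, Functor.map_zero, zero_comp]
  · simp

/-- The equivariant object `⨁_g F_g X` induced from `X`. -/
noncomputable def ind (X : C) : EquivariantObject A where
  X := A.indObj X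
  α h :=
    { hom := A.indα X h
      inv := A.indαInv X h
      hom_inv_id := ind_hom_ext fun m => by
        rw [← cancel_epi (A.mulIsoApp (mul_inv_cancel_left h m) X).hom, reassoc_of% A.ι_indα,
          A.ι_indαInv X (mul_inv_cancel_left h m), Category.comp_id]
      inv_hom_id := map_ind_hom_ext _ fun g => by
        rw [reassoc_of% (A.ι_indαInv X rfl), A.ι_indα, Category.comp_id] }
  rel g h := ind_hom_ext fun m => by
    have e : g * h * ((g * h)⁻¹ * m) = m := mul_inv_cancel_left _ _
    have e' : g * (h * ((g * h)⁻¹ * m)) = m := by rw [← mul_assoc, e]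
    -- On the summand `F_m X` with `m = ghl`, precomposed with `F_g F_h F_l X ≅ F_m X`, both sides
    -- are `F_g F_h` of the inclusion of `F_l X`, followed by `ε_{g,h}`.
    rw [← A.mulIsoApp_rfl_hom, ← cancel_epi (A.mulIsoApp e X).hom,
      ← cancel_epi (A.mulIsoApp (rfl : g * h = _) _).hom, A.ι_indα,
      reassoc_of% (A.mulIsoApp_assoc rfl e rfl e'), reassoc_of% A.ι_indα, ← A.mulIsoApp_naturality,
      ← Functor.map_comp_assoc, ← Functor.map_comp_assoc, Category.assoc, A.ι_indα]

/-- The morphism `⨁_g F_g X ⟶ P` given by a morphism `X ⟶ P`. -/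
noncomputable def indDescHom {X : C} (P : EquivariantObject A) (f : X ⟶ P.X) :
    A.indObj X ⟶ P.X :=
  biproduct.desc fun g => (A.F g).map f ≫ (P.α g).inv

lemma ι_indDescHom {X : C} (P : EquivariantObject A) (f : X ⟶ P.X) (g : G) :
    A.indι X g ≫ A.indDescHom P f = (A.F g).map f ≫ (P.α g).inv :=
  biproduct.ι_desc _ _

lemma indDescHom_comm {X : C} (P : EquivariantObject A) (f : X ⟶ P.X) (h : G) :
    A.indDescHom P f ≫ (P.α h).hom = A.indα X h ≫ (A.F h).map (A.indDescHom P f) :=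
  ind_hom_ext fun m => by
    have e : h * (h⁻¹ * m) = m := mul_inv_cancel_left _ _
    rw [← cancel_epi (A.mulIsoApp e X).hom, reassoc_of% A.ι_indα, ← Functor.map_comp,
      A.ι_indDescHom,
      reassoc_of% A.ι_indDescHom, ← reassoc_of% A.mulIsoApp_naturality,
      P.mulIsoApp_α_inv_α, Functor.map_comp]

/-- The morphism `Ind X ⟶ P` of equivariant objects given by a morphism `X ⟶ P`. -/
noncomputable def indDesc {X : C} (P : EquivariantObject A) (f : X ⟶ P.X) : A.ind X ⟶ P where
  f := A.indDescHom P f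
  comm := A.indDescHom_comm P f

/-- The endomorphism of `⨁_g F_g X` acting on `F_g X` by `χ(g)`. -/
noncomputable def indTwistHom (χ : G →* kˣ) (X : C) : A.indObj X ⟶ A.indObj X :=
  biproduct.desc fun g => (χ g : k) • A.indι X g

lemma ι_indTwistHom (χ : G →* kˣ) (X : C) (g : G) :
    A.indι X g ≫ A.indTwistHom χ X = (χ g : k) • A.indι X g :=
  biproduct.ι_desc _ _

lemma indTwistHom_π (χ : G →* kˣ) (X : C) (g : G) :
    A.indTwistHom χ X ≫ A.indπ X g = (χ g : k) • A.indπ X g :=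
  ind_hom_ext fun h => by
    classical
    rw [reassoc_of% A.ι_indTwistHom, Linear.smul_comp, Linear.comp_smul]
    by_cases hgh : h = g
    · rw [hgh]
    · rw [biproduct.ι_π_ne _ hgh, smul_zero, smul_zero]

/-- The structure map identifies `F_m X` with `F_h F_{h⁻¹m} X`, and the weights agree because
`χ(h⁻¹)χ(m) = χ(h⁻¹m)`. -/
lemma indTwistHom_comm (χ : G →* kˣ) (X : C) (h : G) :
    A.indTwistHom χ X ≫ ((χ h⁻¹ : k) • A.indα X h) =
      A.indα X h ≫ (A.F h).map (A.indTwistHom χ X) :=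
  ind_hom_ext fun m => by
    have e : h * (h⁻¹ * m) = m := mul_inv_cancel_left _ _
    rw [← cancel_epi (A.mulIsoApp e X).hom, reassoc_of% A.ι_indα, ← Functor.map_comp,
      A.ι_indTwistHom,
      reassoc_of% A.ι_indTwistHom, Functor.map_smul, Linear.smul_comp, Linear.comp_smul,
      Linear.comp_smul, Linear.comp_smul, A.ι_indα, smul_smul, mul_comm, ← Units.val_mul,
      ← map_mul]

/-- The morphism `Ind X ⟶ F_χ (Ind X)` acting on `F_g X` by `χ(g)`. -/
noncomputable def indTwist (χ : G →* kˣ) (X : C) : A.ind X ⟶ (A.dualFunctor χ).obj (A.ind X) where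
  f := A.indTwistHom χ X
  comm := A.indTwistHom_comm χ X

end LinearAction

namespace EquivariantAutoequivalence

variable {A}

/-! ### Descending isomorphisms from equivariantizations -/

section Descent

variable (E : EquivariantAutoequivalence A) (Φ : E.equivariantFunctor ≅ 𝟭 (EquivariantObject A))

/-- The morphism underlying `Φ` at `Ind X`. -/
noncomputable def indComponent (X : C) : E.F.obj (A.indObj X) ≅ A.indObj X where
  hom := (Φ.hom.app (A.ind X)).f
  inv := (Φ.inv.app (A.ind X)).f
  hom_inv_id := congrArg EquivariantObject.Hom.f (Φ.hom_inv_id_app (A.ind X))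
  inv_hom_id := congrArg EquivariantObject.Hom.f (Φ.inv_hom_id_app (A.ind X))

lemma indComponent_comm (X : C) (h : G) :
    (E.indComponent Φ X).hom ≫ A.indα X h =
      E.F.map (A.indα X h) ≫ (E.δApp h _).hom ≫ (A.F h).map (E.indComponent Φ X).hom :=
  ((Φ.hom.app (A.ind X)).comm h).trans (Category.assoc _ _ _)

lemma indComponent_naturality {X Y : C} (f : X ⟶ (A.ind Y).X) :
    E.F.map (A.indDescHom (A.ind Y) f) ≫ (E.indComponent Φ Y).hom =
      (E.indComponent Φ X).hom ≫ A.indDescHom (A.ind Y) f :=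
  congrArg EquivariantObject.Hom.f (Φ.hom.naturality (A.indDesc (A.ind Y) f))

/-- Naturality of `Φ` along `Ind X ⟶ F_χ (Ind X)`; by `hΦ`, the components of `Φ` at these two
objects have the same underlying morphism. -/
lemma indComponent_twist
    (hΦ : ∀ (χ : G →* kˣ) (P : EquivariantObject A),
      (Φ.hom.app ((A.dualFunctor χ).obj P)).f = (Φ.hom.app P).f) (χ : G →* kˣ) (X : C) :
    E.F.map (A.indTwistHom χ X) ≫ (E.indComponent Φ X).hom =
      (E.indComponent Φ X).hom ≫ A.indTwistHom χ X := by
  have h := congrArg EquivariantObject.Hom.f (Φ.hom.naturality (A.indTwist χ X))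
  have h1 := hΦ χ (A.ind X)
  exact (congrArg (E.F.map (A.indTwistHom χ X) ≫ ·) h1).symm.trans h

/-- The component of `Φ` at `Ind X` along the summand `F_g X`. -/
noncomputable def diagComponent (X : C) (g : G) : E.F.obj ((A.F g).obj X) ⟶ (A.F g).obj X :=
  E.F.map (A.indι X g) ≫ (E.indComponent Φ X).hom ≫ A.indπ X g

/-- The condition that the components of `Φ` at induced objects are diagonal. -/
def IsDiagonal : Prop :=
  ∀ (X : C) (g h : G), g ≠ h →
    E.F.map (A.indι X g) ≫ (E.indComponent Φ X).hom ≫ A.indπ X h = 0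

/-- Commutation with the twist makes `χ(g) - χ(h)` annihilate the entry from summand `g` to summand
`h`. -/
lemma isDiagonal_of_separating (hsep : ∀ g h : G, g ≠ h → ∃ χ : G →* kˣ, χ g ≠ χ h)
    (hΦ : ∀ (χ : G →* kˣ) (P : EquivariantObject A),
      (Φ.hom.app ((A.dualFunctor χ).obj P)).f = (Φ.hom.app P).f) : E.IsDiagonal Φ := by
  intro X g h hgh
  obtain ⟨χ, hχ⟩ := hsep g h hgh
  have h1 := congrArg (fun f => E.F.map (A.indι X g) ≫ f ≫ A.indπ X h)
    (E.indComponent_twist Φ hΦ χ X)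
  simp only [Category.assoc] at h1
  rw [← Functor.map_comp_assoc, A.ι_indTwistHom, A.indTwistHom_π, Functor.map_smul,
    Linear.smul_comp, Linear.comp_smul, Linear.comp_smul, ← sub_eq_zero, ← sub_smul] at h1
  exact (smul_eq_zero.1 h1).resolve_left (sub_ne_zero.2 fun h => hχ (Units.ext h))

variable {Φ}

lemma IsDiagonal.map_ι_indComponent (hd : E.IsDiagonal Φ) (X : C) (g : G) :
    E.F.map (A.indι X g) ≫ (E.indComponent Φ X).hom = E.diagComponent Φ X g ≫ A.indι X g := by
  classical
  refine biproduct.hom_ext _ _ fun h => ?_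
  rw [Category.assoc, Category.assoc]
  by_cases hgh : g = h
  · subst hgh
    rw [biproduct.ι_π_self, Category.comp_id]
    rfl
  · rw [biproduct.ι_π_ne _ hgh, comp_zero]
    exact hd X g h hgh

lemma IsDiagonal.indComponent_π (hd : E.IsDiagonal Φ) (X : C) (g : G) :
    (E.indComponent Φ X).hom ≫ A.indπ X g = E.F.map (A.indπ X g) ≫ E.diagComponent Φ X g := by
  classical
  refine LinearAction.map_ind_hom_ext _ fun h => ?_
  rw [← Functor.map_comp_assoc]
  by_cases hgh : h = g
  · subst hgh
    rw [biproduct.ι_π_self, CategoryTheory.Functor.map_id, Category.id_comp]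
    rfl
  · rw [biproduct.ι_π_ne _ hgh, Functor.map_zero, zero_comp]
    exact hd X h g hgh

/-- `diagComponent` as an isomorphism. -/
noncomputable def IsDiagonal.diagIso (hd : E.IsDiagonal Φ) (X : C) (g : G) :
    E.F.obj ((A.F g).obj X) ≅ (A.F g).obj X where
  hom := E.diagComponent Φ X g
  inv := A.indι X g ≫ (E.indComponent Φ X).inv ≫ E.F.map (A.indπ X g)
  hom_inv_id := by
    classical
    rw [← reassoc_of% hd.map_ι_indComponent, Iso.hom_inv_id_assoc, ← Functor.map_comp,
      biproduct.ι_π_self, CategoryTheory.Functor.map_id]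
  inv_hom_id := by
    classical
    simp only [Category.assoc]
    rw [← hd.indComponent_π, Iso.inv_hom_id_assoc, biproduct.ι_π_self]

/-- Equivariance of `Φ` at `Ind X`, read on one summand: diagonal entries are compatible with left
translation. -/
lemma IsDiagonal.map_mulIsoApp_diagIso (hd : E.IsDiagonal Φ) (X : C) {h g m : G}
    (e : h * g = m) :
    E.F.map (A.mulIsoApp e X).hom ≫ (hd.diagIso E X m).hom =
      (E.δApp h ((A.F g).obj X)).hom ≫ (A.F h).map (hd.diagIso E X g).hom ≫
        (A.mulIsoApp e X).hom := by
  classical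
  change _ ≫ E.diagComponent Φ X m = _ ≫ (A.F h).map (E.diagComponent Φ X g) ≫ _
  have hmono : Mono ((A.mulIsoApp e X).inv ≫ (A.F h).map (A.indι X g)) := inferInstance
  rw [← cancel_mono ((A.mulIsoApp e X).inv ≫ (A.F h).map (A.indι X g))]
  simp only [Category.assoc, Iso.hom_inv_id_assoc]
  rw [← Functor.map_comp, ← hd.map_ι_indComponent, Functor.map_comp,
    ← reassoc_of% E.δApp_naturality,
    ← A.ι_indα X e, Iso.inv_hom_id_assoc, ← reassoc_of% hd.map_ι_indComponent,
    E.indComponent_comm]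
  simp only [Functor.map_comp, Category.assoc]

/-- By the universal property of induction, `f` gives a morphism `Ind X ⟶ Ind Y` carrying summand
`g` into summand `gs`; naturality of `Φ` along it is read on summand `g`. Taking `f = 𝟙` gives
compatibility with right translation. -/
lemma IsDiagonal.diagIso_naturality_aux (hd : E.IsDiagonal Φ) {X Y : C} {g s m : G}
    (e : g * s = m) (f : X ⟶ (A.F s).obj Y) :
    E.F.map ((A.F g).map f ≫ (A.mulIsoApp e Y).hom) ≫ (hd.diagIso E Y m).hom =
      (hd.diagIso E X g).hom ≫ (A.F g).map f ≫ (A.mulIsoApp e Y).hom := by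
  obtain ⟨t, ht, ht'⟩ : ∃ t : A.indObj X ⟶ A.indObj Y,
      A.indι X g ≫ t = (A.F g).map f ≫ (A.mulIsoApp e Y).hom ≫ A.indι Y m ∧
      E.F.map t ≫ (E.indComponent Φ Y).hom = (E.indComponent Φ X).hom ≫ t := by
    refine ⟨A.indDescHom (A.ind Y) (f ≫ A.indι Y s), ?_, E.indComponent_naturality Φ _⟩
    refine (A.ι_indDescHom (A.ind Y) _ g).trans ?_
    refine (congrArg (· ≫ ((A.ind Y).α g).inv) ((A.F g).map_comp f (A.indι Y s))).trans ?_
    refine (Category.assoc _ _ _).trans (congrArg ((A.F g).map f ≫ ·) ?_)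
    exact A.ι_indαInv Y e
  rw [← cancel_mono (A.indι Y m), Category.assoc]
  change _ ≫ E.diagComponent Φ Y m ≫ _ = (E.diagComponent Φ X g ≫ _) ≫ _
  rw [← hd.map_ι_indComponent, ← Functor.map_comp_assoc, Category.assoc, Category.assoc,
    Category.assoc, ← ht, Functor.map_comp_assoc, ht', reassoc_of% hd.map_ι_indComponent]

lemma IsDiagonal.map_mulIsoApp_diagIso' (hd : E.IsDiagonal Φ) (X : C) {g s m : G}
    (e : g * s = m) :
    E.F.map (A.mulIsoApp e X).hom ≫ (hd.diagIso E X m).hom =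
      (hd.diagIso E ((A.F s).obj X) g).hom ≫ (A.mulIsoApp e X).hom := by
  simpa using hd.diagIso_naturality_aux E e (𝟙 ((A.F s).obj X))

lemma IsDiagonal.diagIso_naturality (hd : E.IsDiagonal Φ) {X Y : C} (f : X ⟶ Y) (g : G) :
    E.F.map ((A.F g).map f) ≫ (hd.diagIso E Y g).hom =
      (hd.diagIso E X g).hom ≫ (A.F g).map f := by
  -- The auxiliary lemma needs a target of the form `F_s Y`, so `f` enters as `F_1 f`; the
  -- isomorphism `F_g F_1 ≅ F_g` is then cancelled.
  have h1 := hd.diagIso_naturality_aux E (mul_one g) ((A.F 1).map f)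
  have h2 := hd.map_mulIsoApp_diagIso' E X (mul_one g)
  rw [A.mulIsoApp_naturality, ← reassoc_of% h2, Functor.map_comp, Category.assoc] at h1
  exact (cancel_epi _).1 h1

/-- The isomorphism `F X ≅ X` obtained by restricting `Φ` at `Ind X` to the summand `F_1 X`. -/
noncomputable def IsDiagonal.descentIso (hd : E.IsDiagonal Φ) (X : C) : E.F.obj X ≅ X :=
  (A.F 1).preimageIso ((E.δApp 1 X).symm ≪≫ hd.diagIso E X 1)

lemma IsDiagonal.δApp_one_descentIso (hd : E.IsDiagonal Φ) (X : C) :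
    (E.δApp 1 X).hom ≫ (A.F 1).map (hd.descentIso E X).hom = (hd.diagIso E X 1).hom := by
  simp [descentIso]

/-- Left translation for `g * 1 = g` determines every diagonal entry from the one at `1`. -/
lemma IsDiagonal.δApp_descentIso (hd : E.IsDiagonal Φ) (X : C) (g : G) :
    (E.δApp g X).hom ≫ (A.F g).map (hd.descentIso E X).hom = (hd.diagIso E X g).hom := by
  rw [← cancel_epi (E.F.map (A.mulIsoApp (mul_one g) X).hom), hd.map_mulIsoApp_diagIso,
    reassoc_of% E.map_mulIsoApp_δApp, ← A.mulIsoApp_naturality, ← hd.δApp_one_descentIso,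
    Functor.map_comp, Category.assoc]

lemma IsDiagonal.descentIso_naturality (hd : E.IsDiagonal Φ) {X Y : C} (f : X ⟶ Y) :
    E.F.map f ≫ (hd.descentIso E Y).hom = (hd.descentIso E X).hom ≫ f := by
  apply (A.F 1).map_injective
  rw [← cancel_epi (E.δApp 1 X).hom, Functor.map_comp, Functor.map_comp,
    ← reassoc_of% E.δApp_naturality, hd.δApp_descentIso, hd.diagIso_naturality,
    ← hd.δApp_descentIso, Category.assoc]

/-- Right translation for `1 * h = h` compares the entry at `1` for `F_h X` with the entry at `h`
for `X`; both are expressed through the descended isomorphism, and `F_1` is faithful. -/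
lemma IsDiagonal.descentIso_comm (hd : E.IsDiagonal Φ) (X : C) (h : G) :
    (E.δApp h X).hom ≫ (A.F h).map (hd.descentIso E X).hom =
      (hd.descentIso E ((A.F h).obj X)).hom := by
  have h1 := hd.map_mulIsoApp_diagIso' E X (one_mul h)
  rw [← hd.δApp_descentIso, ← hd.δApp_descentIso, reassoc_of% E.map_mulIsoApp_δApp,
    ← A.mulIsoApp_naturality, Category.assoc, cancel_epi, ← Functor.map_comp_assoc,
    cancel_mono] at h1
  exact (A.F 1).map_injective h1

lemma IsDiagonal.isomorphic_one (hd : E.IsDiagonal Φ) : E.Isomorphic (one A) :=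
  ⟨NatIso.ofComponents (hd.descentIso E) (hd.descentIso_naturality E), fun g X =>
    (hd.descentIso_comm E X g).trans (Category.comp_id _).symm⟩

end Descent

lemma isomorphic_one_of_equivariantization
    (hsep : ∀ g h : G, g ≠ h → ∃ χ : G →* kˣ, χ g ≠ χ h) (E : EquivariantAutoequivalence A)
    (h : E.equivariantization.Isomorphic (one A.dual)) : E.Isomorphic (one A) := by
  obtain ⟨Φ, hΦ⟩ := h
  refine (E.isDiagonal_of_separating (Φ := Φ) hsep fun χ P => ?_).isomorphic_one
  -- Both dual equivariant structures are identities on underlying objects, so compatibility says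
  -- that `Φ` has the same underlying component at `F_χ P` and at `P`.
  have h1 := congrArg EquivariantObject.Hom.f (hΦ χ P)
  exact ((Category.id_comp _).symm.trans (h1.trans (Category.comp_id _))).symm

end EquivariantAutoequivalence

lemma equivariantizationHom_injective
    (hsep : ∀ g h : G, g ≠ h → ∃ χ : G →* kˣ, χ g ≠ χ h) :
    Function.Injective (equivariantizationHom A) :=
  (injective_iff_map_eq_one _).2 fun x hx => by
    obtain ⟨E, rfl⟩ := LinearAction.cls_surjective x
    exact LinearAction.cls_eq_cls.2
      (EquivariantAutoequivalence.isomorphic_one_of_equivariantization hsep E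
        (LinearAction.cls_eq_cls.1 hx))

end Equivariantization

/-! ### Restriction to `Act`: image, surjectivity and the isomorphism -/

namespace Equivariantization

universe w x v u

variable {k : Type w} [Field k] {C : Type u} [Category.{v} C] [Preadditive C] [Linear k C]
  {G : Type x} [CommGroup G]

open LinearAction

lemma equivariantizationHom_twistedTranslation (A : LinearAction k G C) (a : G) (χ : G →* kˣ) :
    equivariantizationHom A (cls (A.twistedTranslation a χ)) =
      cls (A.dual.twistedTranslation χ⁻¹ (MonoidHom.eval a⁻¹)) :=
  cls_eq_cls.2 (twistedTranslation_equivariantization a χ)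

lemma CenterEqScalars.equivariantizationHom_mem_act (hC : CenterEqScalars k C)
    {A : LinearAction k G C} {x : A.AutGroup} (hx : x ∈ A.act) :
    equivariantizationHom A x ∈ A.dual.act := by
  obtain ⟨E, rfl, a, ⟨ψ⟩⟩ := hx
  obtain ⟨χ, hχ⟩ := hC.exists_isomorphic_twistedTranslation E ψ
  rw [cls_eq_cls.2 hχ, equivariantizationHom_twistedTranslation]
  exact twistedTranslation_mem_act _ _ _

lemma SplitsOver.exists_equivariantizationHom_eq [Finite G] (hG : SplitsOver k G)
    {A : LinearAction k G C} (hCG : CenterEqScalars k (EquivariantObject A))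
    {y : A.dual.AutGroup} (hy : y ∈ A.dual.act) :
    ∃ x ∈ A.act, equivariantizationHom A x = y := by
  obtain ⟨E, rfl, χ, ⟨ψ⟩⟩ := hy
  obtain ⟨l, hl⟩ := hCG.exists_isomorphic_twistedTranslation E ψ
  obtain ⟨a, ha⟩ := hG.exists_eval_eq l
  -- Both parameters are inverted because equivariantization sends `(a, χ)` to `(χ⁻¹, ev_{a⁻¹})`.
  refine ⟨_, A.twistedTranslation_mem_act a⁻¹ χ⁻¹, ?_⟩
  have h1 : l = MonoidHom.eval a := MonoidHom.ext ha
  have h2 : χ⁻¹⁻¹ = χ := inv_inv χ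
  rw [equivariantizationHom_twistedTranslation, cls_eq_cls.2 hl, inv_inv, h1, h2]

end Equivariantization

theorem proposition5p6 {k : Type*} [Field k] {G : Type*} [CommGroup G] [Finite G]
    (hG : Equivariantization.SplitsOver k G)
    {C : Type*} [Category C] [Preadditive C] [Linear k C] [HasFiniteBiproducts C]
    [IsIdempotentComplete C]
    (A : Equivariantization.LinearAction k G C)
    (hC : Equivariantization.CenterEqScalars k C)
    (hCG : Equivariantization.CenterEqScalars k (Equivariantization.EquivariantObject A)) :
    ∃ e : A.act ≃* A.dual.act,
      ∀ x : A.act, (e x : A.dual.AutGroup) =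
        Equivariantization.equivariantizationHom A (x : A.AutGroup) := by
  let f : A.act →* A.dual.act :=
    ((Equivariantization.equivariantizationHom A).comp A.act.subtype).codRestrict A.dual.act
      fun x => hC.equivariantizationHom_mem_act x.2
  have hf : Function.Bijective f := by
    constructor
    · intro x y hxy
      exact Subtype.ext (Equivariantization.equivariantizationHom_injective A
        (fun g h hgh => hG.exists_character_ne hgh) (congrArg Subtype.val hxy))
    · rintro ⟨y, hy⟩
      obtain ⟨x, hx, rfl⟩ := hG.exists_equivariantizationHom_eq hCG hy
      exact ⟨⟨x, hx⟩, rfl⟩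
  exact ⟨MulEquiv.ofBijective f hf, fun x => rfl⟩
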